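/- Let $a>0$, $b>0$ and $\tau$ be real numbers, and let $h:[0,\infty)\to\mathbb R$ be a Lebesgue measurable function with $h(t)\le t$ and $t-h(t)\le\tau$ for all $t\ge 0$. If $a^2\ge 4b$ and $\tau b<a$, then the equation $$\ddot x(t)+a\dot x(t)+b\,x(h(t))=0$$ (that is, $\ddot x(t)+a\dot x(g(t))+b\,x(h(t))=0$ with $g(t)\equiv t$) is uniformly exponentially stable, in the following sense. There are constants $M>0$ and $\mu>0$ such that for every $t_0\ge 0$, all bounded Borel measurable functions $\varphi,\psi:(-\infty,t_0)\to\mathbb R$ and all $x_0,x_0'\in\mathbb R$, the solution $x$ of the equation on $[t_0,\infty)$ with $x(t)=\varphi(t)$, $\dot x(t)=\psi(t)$ for $t<t_0$, $x(t_0)=x_0$, $\dot x(t_0)=x_0'$ satisfies $$|x(t)|\le M e^{-\mu(t-t_0)}\Big[|x_0|+|x_0'|+\sup_{s<t_0}\big(|\varphi(s)|+|\psi(s)|\big)\Big],\qquad t\ge t_0.$$ Here a solution is a function $x$ that takes the prescribed initial data and is differentiable on $[t_0,\infty)$ (from the right at $t_0$), whose derivative $\dot x$ is locally absolutely continuous on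 $[t_0,\infty)$, and which satisfies the equation for almost every $t\ge t_0$; for $t<t_0$ the values $\dot x(t)=\psi(t)$ are prescribed independently of $\varphi$. -/

import Mathlib

open Set MeasureTheory

/-- `IsDelaySolution a b g h t₀ φ ψ x₀ v₀ x v`: the function `x` is a solution of the initial
value problem
`x''(t) + a(t) x'(g(t)) + b(t) x(h(t)) = 0` for almost every `t ≥ t₀`,
`x(t) = φ(t)`, `x'(t) = ψ(t)` for `t < t₀`, `x(t₀) = x₀`, `x'(t₀) = v₀`.

The function `v` stands for `x'`: on `[t₀, ∞)` it is the derivative of `x` (the one from the right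
at `t₀`) and it is locally absolutely continuous there; before `t₀` it is the prescribed function
`ψ`, which need not be the derivative of `φ`. Neither `φ` nor `ψ` has to match the initial values
at `t₀`. -/
structure IsDelaySolution (a b g h : ℝ → ℝ) (t₀ : ℝ) (φ ψ : Iio t₀ → ℝ) (x₀ v₀ : ℝ)
    (x v : ℝ → ℝ) : Prop where
  /-- the prehistory of `x` -/
  hist : ∀ s : Iio t₀, x s = φ s
  /-- the prehistory of `x'` -/
  hist_deriv : ∀ s : Iio t₀, v s = ψ s
  init : x t₀ = x₀
  init_deriv : v t₀ = v₀
  hasDeriv : ∀ t, t₀ ≤ t → HasDerivWithinAt x (v t) (Ici t₀) t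
  locallyAC : ∀ T, t₀ ≤ T → AbsolutelyContinuousOnInterval v t₀ T
  equation : ∀ᵐ t ∂(volume.restrict (Ici t₀)),
    HasDerivAt v (-(a t * v (g t)) - b t * x (h t)) t

/-- Uniform exponential stability of `x''(t) + a(t) x'(g(t)) + b(t) x(h(t)) = 0`: the solutions of
all initial value problems with initial time `t₀ ≥ 0` and bounded Borel initial functions decay
exponentially, with constants `M` and `μ` that depend neither on `t₀` nor on the initial data. -/
def IsExponentiallyStable (a b g h : ℝ → ℝ) : Prop :=
  ∃ M μ : ℝ, 0 < M ∧ 0 < μ ∧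
    ∀ t₀ : ℝ, 0 ≤ t₀ → ∀ φ ψ : Iio t₀ → ℝ, Measurable φ → Measurable ψ →
      (∃ C : ℝ, ∀ s, |φ s| ≤ C) → (∃ C : ℝ, ∀ s, |ψ s| ≤ C) →
      ∀ (x₀ v₀ : ℝ) (x v : ℝ → ℝ), IsDelaySolution a b g h t₀ φ ψ x₀ v₀ x v →
        ∀ t : ℝ, t₀ ≤ t →
          |x t| ≤ M * Real.exp (-μ * (t - t₀)) *
            (|x₀| + |v₀| + ⨆ s : Iio t₀, (|φ s| + |ψ s|))

/-! Since `a ^ 2 ≥ 4 * b`, one has `a = p + q`, `b = p * q` with real `p, q > 0`, and the equation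
becomes `(D + p) (D + q) x = b (x - x ∘ h)`. Inverting `D + λ` has sup-norm gain `1 / λ`, so `x` is
controlled by `x - x ∘ h` with gain `b / (p q) = 1`. The delay difference is at most `τ sup |x'|`,
and `x'' + a x' = -b x ∘ h` bounds `x'` by `x` with gain `b / a`. The loop gain is `τ b / a < 1`. By
continuity it stays below 1 for norms weighted by `exp (mu t)` with small `mu > 0`, which gives the
decay. -/

/-! ### Scalar decay estimates. -/

/-- An absolutely continuous solution of `y' = -lam y + f` with exponentially decaying forcing
decays at the rate of the forcing, provided that rate is less than `lam`. -/
theorem abs_le_of_ae_hasDerivAt_neg_mul_add {y f : ℝ → ℝ} {t₀ T lam mu F : ℝ} (hT : t₀ ≤ T)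
    (hmu : mu < lam) (hF : 0 ≤ F) (hy : AbsolutelyContinuousOnInterval y t₀ T)
    (hderiv : ∀ᵐ t, t ∈ Icc t₀ T → HasDerivAt y (-lam * y t + f t) t)
    (hf : ∀ t ∈ Icc t₀ T, |f t| ≤ F * Real.exp (-mu * (t - t₀))) :
    |y T| ≤ Real.exp (-mu * (T - t₀)) * (|y t₀| + F / (lam - mu)) := by
  have hpos : 0 < lam - mu := sub_pos.2 hmu
  have hE : ∀ k t : ℝ, HasDerivAt (fun t => Real.exp (k * (t - t₀)))
      (Real.exp (k * (t - t₀)) * k) t := fun k t => by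
    simpa using (((hasDerivAt_id t).sub_const t₀).const_mul k).exp
  have hEac : AbsolutelyContinuousOnInterval (fun t => Real.exp (lam * (t - t₀))) t₀ T := by
    refine ContDiffOn.absolutelyContinuousOnInterval (ContDiff.contDiffOn ?_)
    fun_prop
  -- Integrating factor: almost everywhere this product has derivative `exp (lam (t - t₀)) f`, and
  -- absolute continuity allows integrating it back.
  have hz := hEac.fun_mul hy
  have hint : ∫ t in t₀..T, F * Real.exp ((lam - mu) * (t - t₀)) =
      F / (lam - mu) * Real.exp ((lam - mu) * (T - t₀)) - F / (lam - mu) := by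
    rw [intervalIntegral.integral_eq_sub_of_hasDerivAt
      (f := fun t => F / (lam - mu) * Real.exp ((lam - mu) * (t - t₀)))]
    · simp
    · intro t _
      refine ((hE (lam - mu) t).const_mul (F / (lam - mu))).congr_deriv ?_
      field_simp
    · exact Continuous.intervalIntegrable (by fun_prop) _ _
  have hbound : ‖∫ t in t₀..T, deriv (fun t => Real.exp (lam * (t - t₀)) * y t) t‖ ≤
      ∫ t in t₀..T, F * Real.exp ((lam - mu) * (t - t₀)) := by
    refine intervalIntegral.norm_integral_le_of_norm_le hT ?_
      (Continuous.intervalIntegrable (by fun_prop) _ _)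
    filter_upwards [hderiv] with t ht htm
    have htm' := Ioc_subset_Icc_self htm
    rw [((hE lam t).fun_mul (ht htm')).deriv]
    have heq : Real.exp (lam * (t - t₀)) * lam * y t +
        Real.exp (lam * (t - t₀)) * (-lam * y t + f t) = Real.exp (lam * (t - t₀)) * f t := by
      ring
    rw [heq, Real.norm_eq_abs, abs_mul, Real.abs_exp]
    calc _ ≤ Real.exp (lam * (t - t₀)) * (F * Real.exp (-mu * (t - t₀))) := by
          gcongr
          exact hf t htm'
      _ = F * (Real.exp (lam * (t - t₀)) * Real.exp (-mu * (t - t₀))) := by ring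
      _ = _ := by rw [← Real.exp_add]; ring_nf
  rw [hz.integral_deriv_eq_sub, hint, Real.norm_eq_abs] at hbound
  simp only [sub_self, mul_zero, Real.exp_zero, one_mul] at hbound
  have hFl : 0 ≤ F / (lam - mu) := by positivity
  have htri : Real.exp (lam * (T - t₀)) * |y T| ≤
      |y t₀| + F / (lam - mu) * Real.exp ((lam - mu) * (T - t₀)) := by
    have := abs_sub_abs_le_abs_sub (Real.exp (lam * (T - t₀)) * y T) (y t₀)
    rw [abs_mul, Real.abs_exp] at this
    linarith
  have hone : 1 ≤ Real.exp ((lam - mu) * (T - t₀)) :=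
    Real.one_le_exp (mul_nonneg hpos.le (sub_nonneg.2 hT))
  have hsplit : Real.exp (lam * (T - t₀)) * Real.exp (-mu * (T - t₀)) =
      Real.exp ((lam - mu) * (T - t₀)) := by rw [← Real.exp_add]; ring_nf
  refine le_of_mul_le_mul_left ?_ (Real.exp_pos (lam * (T - t₀)))
  rw [← mul_assoc, hsplit]
  nlinarith [abs_nonneg (y t₀)]

/-- The small-gain condition of the limit case `mu = 0` persists for small positive `mu`. -/
theorem exists_pos_rate_gain_lt_one {a τ p q : ℝ} (ha : 0 < a) (hp : 0 < p) (hq : 0 < q)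
    (h : τ * (p * q) < a) :
    ∃ mu : ℝ, 0 < mu ∧ mu < a ∧ mu < p ∧ mu < q ∧
      p * q * Real.exp (mu * τ) * (τ * (p * q * Real.exp (mu * τ) / (a - mu))) /
        (p - mu) / (q - mu) < 1 := by
  have hcont : ContinuousAt (fun mu : ℝ => p * q * Real.exp (mu * τ) *
      (τ * (p * q * Real.exp (mu * τ) / (a - mu))) / (p - mu) / (q - mu)) 0 := by
    fun_prop (disch := simp; positivity)
  have hzero : p * q * Real.exp (0 * τ) * (τ * (p * q * Real.exp (0 * τ) / (a - 0))) /
      (p - 0) / (q - 0) < 1 := by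
    have : p * q * Real.exp (0 * τ) * (τ * (p * q * Real.exp (0 * τ) / (a - 0))) /
        (p - 0) / (q - 0) = τ * (p * q) / a := by
      simp only [zero_mul, Real.exp_zero, sub_zero]
      field_simp
    rw [this, div_lt_one ha]
    exact h
  have hev := ((hcont.eventually_lt_const hzero).and
    ((eventually_lt_nhds ha).and ((eventually_lt_nhds hp).and (eventually_lt_nhds hq)))).filter_mono
      (nhdsWithin_le_nhds (s := Ioi 0))
  obtain ⟨mu, ⟨h1, h2, h3, h4⟩, h5⟩ := (hev.and self_mem_nhdsWithin).exists
  exact ⟨mu, h5, h2, h3, h4, h1⟩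

/-- A delay of at most `τ` costs at most a factor `exp (mu τ)` in an exponential bound. -/
theorem exp_neg_mul_sub_le {mu τ s r t₀ : ℝ} (hmu : 0 ≤ mu) (h : s - r ≤ τ) :
    Real.exp (-mu * (r - t₀)) ≤ Real.exp (mu * τ) * Real.exp (-mu * (s - t₀)) := by
  rw [← Real.exp_add]
  exact Real.exp_le_exp.2 (by nlinarith)

/-! ### A priori bounds for solutions. -/

namespace IsDelaySolution

variable {A B g h : ℝ → ℝ} {t₀ x₀ v₀ : ℝ} {φ ψ : Iio t₀ → ℝ} {x v : ℝ → ℝ}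

theorem continuousOn (H : IsDelaySolution A B g h t₀ φ ψ x₀ v₀ x v) : ContinuousOn x (Ici t₀) :=
  fun t ht => (H.hasDeriv t ht).continuousWithinAt

/-- The derivative `v` is bounded on the compact interval, so `x` is Lipschitz there. -/
theorem absolutelyContinuousOnInterval (H : IsDelaySolution A B g h t₀ φ ψ x₀ v₀ x v) {T : ℝ}
    (hT : t₀ ≤ T) : AbsolutelyContinuousOnInterval x t₀ T := by
  obtain ⟨C, hC⟩ := (H.locallyAC T hT).exists_bound
  have hlip : LipschitzOnWith C.toNNReal x (uIcc t₀ T) := by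
    refine (convex_uIcc t₀ T).lipschitzOnWith_of_nnnorm_hasDerivWithin_le (f' := v) ?_ ?_
    · intro t ht
      rw [uIcc_of_le hT] at ht ⊢
      exact (H.hasDeriv t ht.1).mono Icc_subset_Ici_self
    · intro t ht
      rw [← NNReal.coe_le_coe, coe_nnnorm]
      exact (hC t ht).trans (Real.le_coe_toNNReal C)
  exact hlip.absolutelyContinuousOnInterval

variable {a b τ mu N T : ℝ}

/-- The equation with constant coefficients and `g t = t`, almost everywhere on `[t₀, ∞)`. -/
theorem ae_hasDerivAt (H : IsDelaySolution (fun _ => a) (fun _ => b) g h t₀ φ ψ x₀ v₀ x v)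
    (ht₀ : 0 ≤ t₀) (hg : ∀ t, 0 ≤ t → g t = t) :
    ∀ᵐ t, t₀ ≤ t → HasDerivAt v (-a * v t + -(b * x (h t))) t := by
  have := (ae_restrict_iff' measurableSet_Ici).1 H.equation
  filter_upwards [this] with t ht hle
  convert ht hle using 1
  rw [hg t (ht₀.trans hle)]
  ring

/-- A bound on `x` gives a bound on `x'`, with gain `b exp (mu τ) / (a - mu)`. -/
theorem abs_deriv_le (H : IsDelaySolution (fun _ => a) (fun _ => b) g h t₀ φ ψ x₀ v₀ x v)
    (hb : 0 < b) (ht₀ : 0 ≤ t₀) (hg : ∀ t, 0 ≤ t → g t = t) (hle : ∀ t, 0 ≤ t → h t ≤ t)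
    (hτ : ∀ t, 0 ≤ t → t - h t ≤ τ) (hmu : 0 < mu) (hmua : mu < a) (hN : 0 ≤ N)
    (hhist : ∀ s < t₀, |x s| ≤ N) {U : ℝ} (hU : 0 ≤ U)
    (hx : ∀ s ∈ Icc t₀ T, |x s| ≤ U * Real.exp (-mu * (s - t₀))) :
    ∀ s ∈ Icc t₀ T, |v s| ≤ (|v₀| + b * Real.exp (mu * τ) * (U + N) / (a - mu)) *
      Real.exp (-mu * (s - t₀)) := by
  intro s hs
  rw [mul_comm, ← H.init_deriv]
  refine abs_le_of_ae_hasDerivAt_neg_mul_add (f := fun t => -(b * x (h t))) hs.1 hmua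
    (by positivity) (H.locallyAC s hs.1) ?_ ?_
  · filter_upwards [H.ae_hasDerivAt ht₀ hg] with t ht hts using ht hts.1
  · intro t ht
    have ht0 : 0 ≤ t := ht₀.trans ht.1
    have hexp := exp_neg_mul_sub_le (t₀ := t₀) hmu.le (hτ t ht0)
    have hdelay : |x (h t)| ≤ (U + N) * Real.exp (-mu * (h t - t₀)) := by
      rcases le_or_gt t₀ (h t) with hht | hht
      · refine (hx _ ⟨hht, (hle t ht0).trans (ht.2.trans hs.2)⟩).trans ?_
        gcongr
        linarith
      -- Before `t₀` the weight is at least 1, so the constant bound `N` suffices.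
      · have : 1 ≤ Real.exp (-mu * (h t - t₀)) := Real.one_le_exp (by nlinarith)
        have := hhist _ hht
        nlinarith
    rw [abs_neg, abs_mul, abs_of_pos hb]
    calc b * |x (h t)| ≤ b * ((U + N) * (Real.exp (mu * τ) * Real.exp (-mu * (t - t₀)))) := by
          gcongr
          exact hdelay.trans (by gcongr)
      _ = _ := by ring

/-- A bound on `x'` controls the change of `x` over the delay. -/
theorem abs_sub_delay_le (H : IsDelaySolution A B g h t₀ φ ψ x₀ v₀ x v)
    (ht₀ : 0 ≤ t₀) (hle : ∀ t, 0 ≤ t → h t ≤ t)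
    (hτ : ∀ t, 0 ≤ t → t - h t ≤ τ) (hmu : 0 < mu)
    (hhist : ∀ s < t₀, |x t₀| + |x s| ≤ N) (hN : 0 ≤ N) {W : ℝ} (hW : 0 ≤ W)
    (hv : ∀ s ∈ Icc t₀ T, |v s| ≤ W * Real.exp (-mu * (s - t₀))) :
    ∀ t ∈ Icc t₀ T, |x t - x (h t)| ≤
      Real.exp (mu * τ) * (τ * W + N) * Real.exp (-mu * (t - t₀)) := by
  intro t ht
  have ht0 : 0 ≤ t := ht₀.trans ht.1
  have hmv : ∀ r ∈ Icc t₀ t, t - r ≤ τ → |x t - x r| ≤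
      Real.exp (mu * τ) * (τ * W) * Real.exp (-mu * (t - t₀)) := by
    intro r hr hrτ
    have := (convex_Icc r t).norm_image_sub_le_of_norm_hasDerivWithin_le (f := x) (f' := v)
      (C := W * (Real.exp (mu * τ) * Real.exp (-mu * (t - t₀))))
      (fun s hs => (H.hasDeriv s (hr.1.trans hs.1)).mono
        (Icc_subset_Ici_self.trans (Ici_subset_Ici.2 hr.1)))
      (fun s hs => (hv s ⟨hr.1.trans hs.1, hs.2.trans ht.2⟩).trans (by
        gcongr
        exact exp_neg_mul_sub_le hmu.le (by linarith [hs.1])))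
      (left_mem_Icc.2 hr.2) (right_mem_Icc.2 hr.2)
    rw [Real.norm_eq_abs, Real.norm_eq_abs, abs_of_nonneg (sub_nonneg.2 hr.2)] at this
    calc _ ≤ _ := this
      _ ≤ W * (Real.exp (mu * τ) * Real.exp (-mu * (t - t₀))) * τ := by gcongr
      _ = _ := by ring
  rcases le_or_gt t₀ (h t) with hht | hht
  · refine (hmv _ ⟨hht, hle t ht0⟩ (hτ t ht0)).trans ?_
    gcongr
    linarith
  -- `x` may jump at `t₀`, so the mean value bound is used only back to `t₀`; the remainder costs
  -- `N`.
  · have htτ : t - t₀ ≤ τ := by linarith [hτ t ht0]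
    have h1 := hmv t₀ ⟨le_rfl, ht.1⟩ htτ
    have h2 : 1 ≤ Real.exp (mu * τ) * Real.exp (-mu * (t - t₀)) := by
      simpa using exp_neg_mul_sub_le (t₀ := t₀) hmu.le htτ
    have h3 := hhist _ hht
    have h4 : |x t - x (h t)| ≤ |x t - x t₀| + (|x t₀| + |x (h t)|) :=
      (abs_sub_le _ (x t₀) _).trans (add_le_add_right (abs_sub _ _) _)
    nlinarith

/-- A bound on `x'` gives a bound on `x`, through the factorization
`D² + (p + q) D + p q = (D + p) (D + q)`. -/
theorem abs_le {p q : ℝ}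
    (H : IsDelaySolution (fun _ => p + q) (fun _ => p * q) g h t₀ φ ψ x₀ v₀ x v)
    (hp : 0 < p) (hq : 0 < q) (ht₀ : 0 ≤ t₀) (hg : ∀ t, 0 ≤ t → g t = t)
    (hle : ∀ t, 0 ≤ t → h t ≤ t)
    (hτ : ∀ t, 0 ≤ t → t - h t ≤ τ) (hmu : 0 < mu) (hmup : mu < p) (hmuq : mu < q)
    (hhist : ∀ s < t₀, |x t₀| + |x s| ≤ N) (hN : 0 ≤ N) {W : ℝ} (hW : 0 ≤ W)
    (hv : ∀ s ∈ Icc t₀ T, |v s| ≤ W * Real.exp (-mu * (s - t₀))) :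
    ∀ s ∈ Icc t₀ T, |x s| ≤ Real.exp (-mu * (s - t₀)) *
      (|x₀| + (|v₀ + q * x₀| + p * q * Real.exp (mu * τ) * (τ * W + N) / (p - mu)) /
        (q - mu)) := by
  have hτ0 : 0 ≤ τ := by linarith [hle t₀ ht₀, hτ t₀ ht₀]
  have hpmu : 0 < p - mu := sub_pos.2 hmup
  have hxd : ∀ t, t₀ < t → HasDerivAt x (v t) t := fun t ht =>
    (H.hasDeriv t ht.le).hasDerivAt (Ici_mem_nhds ht)
  -- At `t₀` only a one-sided derivative of `x` is available.
  have hne : ∀ᵐ t : ℝ, t ≠ t₀ := by simp [ae_iff]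
  have hy : ∀ s ∈ Icc t₀ T, |v s + q * x s| ≤ Real.exp (-mu * (s - t₀)) *
      (|v₀ + q * x₀| + p * q * Real.exp (mu * τ) * (τ * W + N) / (p - mu)) := by
    intro s hs
    rw [← H.init_deriv, ← H.init]
    refine abs_le_of_ae_hasDerivAt_neg_mul_add (y := fun t => v t + q * x t)
      (f := fun t => p * q * (x t - x (h t))) hs.1 hmup
      (by positivity) ((H.locallyAC s hs.1).fun_add
        ((H.absolutelyContinuousOnInterval hs.1).const_mul q)) ?_ ?_
    · filter_upwards [H.ae_hasDerivAt ht₀ hg, hne] with t ht htne hts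
      refine ((ht hts.1).fun_add
        ((hxd t (lt_of_le_of_ne hts.1 htne.symm)).const_mul q)).congr_deriv ?_
      ring
    · intro t ht
      have := H.abs_sub_delay_le ht₀ hle hτ hmu hhist hN hW hv t ⟨ht.1, ht.2.trans hs.2⟩
      rw [abs_mul, abs_of_pos (mul_pos hp hq)]
      calc _ ≤ p * q * (Real.exp (mu * τ) * (τ * W + N) * Real.exp (-mu * (t - t₀))) := by
            gcongr
        _ = _ := by ring
  intro s hs
  rw [← H.init_deriv, ← H.init] at *
  refine abs_le_of_ae_hasDerivAt_neg_mul_add (f := fun t => v t + q * x t) hs.1 hmuq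
    (by positivity) (H.absolutelyContinuousOnInterval hs.1) ?_ ?_
  · filter_upwards [hne] with t htne hts
    exact (hxd t (lt_of_le_of_ne hts.1 htne.symm)).congr_deriv (by ring)
  · intro t ht
    rw [mul_comm _ (Real.exp _)]
    exact hy t ⟨ht.1, ht.2.trans hs.2⟩

/-- The prehistory of `x`, together with the initial values, is bounded by the norm of the
initial data. -/
theorem abs_init_add_abs_hist_le (H : IsDelaySolution A B g h t₀ φ ψ x₀ v₀ x v)
    (hφ : ∃ C : ℝ, ∀ s, |φ s| ≤ C) (hψ : ∃ C : ℝ, ∀ s, |ψ s| ≤ C) :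
    ∀ s < t₀, |x t₀| + |x s| ≤ |x₀| + |v₀| + ⨆ s : Iio t₀, (|φ s| + |ψ s|) := by
  intro s hs
  obtain ⟨C, hC⟩ := hφ
  obtain ⟨D, hD⟩ := hψ
  have hbdd : BddAbove (range fun s : Iio t₀ => |φ s| + |ψ s|) :=
    ⟨C + D, by rintro _ ⟨r, rfl⟩; exact add_le_add (hC r) (hD r)⟩
  have := le_ciSup hbdd ⟨s, mem_Iio.2 hs⟩
  have hxs : x s = φ ⟨s, mem_Iio.2 hs⟩ := H.hist ⟨s, mem_Iio.2 hs⟩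
  rw [H.init, hxs]
  linarith [abs_nonneg (ψ ⟨s, mem_Iio.2 hs⟩), abs_nonneg v₀]

end IsDelaySolution

/-! ### Closing the small-gain loop. -/

/-- Exponential stability under the small-gain condition, with the characteristic polynomial of
the equation without delay given by its roots `-p` and `-q`. -/
theorem isExponentiallyStable_of_mul_lt {p q τ : ℝ} (hp : 0 < p) (hq : 0 < q) {g h : ℝ → ℝ}
    (hg : ∀ t, 0 ≤ t → g t = t) (hle : ∀ t, 0 ≤ t → h t ≤ t) (hτ : ∀ t, 0 ≤ t → t - h t ≤ τ)
    (hpq : τ * (p * q) < p + q) :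
    IsExponentiallyStable (fun _ => p + q) (fun _ => p * q) g h := by
  obtain ⟨mu, hmu, hmua, hmup, hmuq, hgain⟩ :=
    exists_pos_rate_gain_lt_one (add_pos hp hq) hp hq hpq
  have hτ0 : 0 ≤ τ := by linarith [hle 0 le_rfl, hτ 0 le_rfl]
  have ha' : 0 < p + q - mu := sub_pos.2 hmua
  have hp' : 0 < p - mu := sub_pos.2 hmup
  have hq' : 0 < q - mu := sub_pos.2 hmuq
  set E := Real.exp (mu * τ) with hE
  have hE0 : 0 < E := Real.exp_pos _
  -- In the composed bounds, `G` is the coefficient of `U`, and `K` that of `N` once all initial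
  -- data are bounded by `N`.
  set G := p * q * E * (τ * (p * q * E / (p + q - mu))) / (p - mu) / (q - mu) with hG
  set K := 1 + (1 + q + p * q * E * (τ * (1 + p * q * E / (p + q - mu)) + 1) / (p - mu)) /
    (q - mu) with hK
  have hG' : 0 < 1 - G := sub_pos.2 hgain
  have hK0 : 0 < K := by positivity
  refine ⟨K / (1 - G), mu, by positivity, hmu, ?_⟩
  intro t₀ ht₀ φ ψ _ _ hφ hψ x₀ v₀ x v H T hT
  have hhist := H.abs_init_add_abs_hist_le hφ hψ
  have hsup : 0 ≤ ⨆ s : Iio t₀, (|φ s| + |ψ s|) := Real.iSup_nonneg fun s => by positivity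
  set N := |x₀| + |v₀| + ⨆ s : Iio t₀, (|φ s| + |ψ s|) with hNdef
  have hx₀N : |x₀| ≤ N := by linarith [abs_nonneg v₀]
  have hv₀N : |v₀| ≤ N := by linarith [abs_nonneg x₀]
  have hN : 0 ≤ N := by positivity
  -- On a compact interval the weighted maximum `U` is finite, so `U ≤ K N + G U` can be solved for
  -- `U`, uniformly in `T`.
  obtain ⟨r, hr, hmax⟩ := isCompact_Icc.exists_isMaxOn (nonempty_Icc.2 hT)
    (f := fun s => |x s| * Real.exp (mu * (s - t₀)))
    ((H.continuousOn.mono Icc_subset_Ici_self).abs.mul (by fun_prop))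
  set U := |x r| * Real.exp (mu * (r - t₀)) with hUdef
  have hU : 0 ≤ U := by positivity
  have hcancel : ∀ s, Real.exp (mu * (s - t₀)) * Real.exp (-mu * (s - t₀)) = 1 := fun s => by
    rw [← Real.exp_add]; simp
  have hxU : ∀ s ∈ Icc t₀ T, |x s| ≤ U * Real.exp (-mu * (s - t₀)) := by
    intro s hs
    have := mul_le_mul_of_nonneg_right (hmax hs) (Real.exp_pos (-mu * (s - t₀))).le
    rwa [mul_assoc, hcancel, mul_one] at this
  have hv := H.abs_deriv_le (mul_pos hp hq) ht₀ hg hle hτ hmu hmua hN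
    (fun s hs => by linarith [hhist s hs, abs_nonneg (x t₀)]) hU hxU
  have hx := H.abs_le hp hq ht₀ hg hle hτ hmu hmup hmuq hhist hN (by positivity) hv r hr
  rw [← hE] at hx
  have hUle : U ≤ |x₀| + (|v₀ + q * x₀| + p * q * E *
      (τ * (|v₀| + p * q * E * (U + N) / (p + q - mu)) + N) / (p - mu)) / (q - mu) := by
    have := mul_le_mul_of_nonneg_right hx (Real.exp_pos (mu * (r - t₀))).le
    rwa [mul_right_comm, mul_comm (Real.exp (-mu * (r - t₀))), hcancel, one_mul] at this
  have hinit : |v₀ + q * x₀| ≤ N + q * N := by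
    refine (abs_add_le _ _).trans (add_le_add hv₀N ?_)
    rw [abs_mul, abs_of_pos hq]
    gcongr
  have hgainU : U ≤ K * N + G * U := by
    calc U ≤ _ := hUle
      _ ≤ N + (N + q * N + p * q * E *
          (τ * (N + p * q * E * (U + N) / (p + q - mu)) + N) / (p - mu)) / (q - mu) := by
        gcongr
      _ = K * N + G * U := by rw [hK, hG]; ring
  have hUfin : U ≤ K / (1 - G) * N := by
    rw [div_mul_eq_mul_div, le_div_iff₀ hG']
    linarith
  calc |x T| ≤ U * Real.exp (-mu * (T - t₀)) := hxU T ⟨hT, le_rfl⟩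
    _ ≤ K / (1 - G) * N * Real.exp (-mu * (T - t₀)) := by gcongr
    _ = _ := by ring

theorem corollary3 (a b τ : ℝ) (ha : 0 < a) (hb : 0 < b) (g h : ℝ → ℝ)
    (hg : ∀ t, 0 ≤ t → g t = t)
    (hmeas : AEMeasurable h (volume.restrict (Ici 0)))
    (hle : ∀ t, 0 ≤ t → h t ≤ t)
    (hτ : ∀ t, 0 ≤ t → t - h t ≤ τ)
    (hab : 4 * b ≤ a ^ 2)
    (hτba : τ * b < a) :
    IsExponentiallyStable (fun _ => a) (fun _ => b) g h := by
  have hd : √(a ^ 2 - 4 * b) ^ 2 = a ^ 2 - 4 * b := Real.sq_sqrt (by linarith)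
  -- Here `b > 0` makes the smaller root `p` positive.
  have hlt : √(a ^ 2 - 4 * b) < a := (Real.sqrt_lt' ha).2 (by linarith)
  have hsum : (a - √(a ^ 2 - 4 * b)) / 2 + (a + √(a ^ 2 - 4 * b)) / 2 = a := by ring
  have hprod : (a - √(a ^ 2 - 4 * b)) / 2 * ((a + √(a ^ 2 - 4 * b)) / 2) = b := by
    linear_combination -hd / 4
  have := isExponentiallyStable_of_mul_lt (p := (a - √(a ^ 2 - 4 * b)) / 2)
    (q := (a + √(a ^ 2 - 4 * b)) / 2) (by linarith) (by positivity) hg hle hτ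
    (by rwa [hsum, hprod])
  rwa [hsum, hprod] at this
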